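/- For integers $q \ge 2$, $p \ge 1$ let $\zeta(q,p) = \sum_{n>m>0} \frac{1}{n^q m^p}$ be the double zeta value of weight $q+p$. Let $\mathcal{DZ}_k \subset \mathbb{R}$ be the $\mathbb{Q}$-vector space spanned by all double zeta values of weight $k$, let $M_k$ be the complex vector space of modular forms of weight $k$ on $\mathrm{SL}(2,\mathbb{Z})$, and let $[x]$ be the greatest integer not exceeding $x$. Let $k \ge 4$ be an even integer. (i) The following linear combinations of double zeta values with odd arguments, whose number (as formal linear combinations) equals $k/2 - \dim M_k$, generate the $\mathbb{Q}$-vector space $\mathcal{DZ}_k$: - $\zeta(j,k-j)$ for odd $j$ with $3 \le j \le [(k+2)/3]$; - $\zeta(k-j,j)$ for odd $j$ with $1 \le j \le [(k+2)/3]$; - $\zeta(j,k-j)+\zeta(k-j,j)$ for odd $j$ with $[(k+5)/3] \le j \le k/2$. (ii) For every odd integer $i$ with $[(k+5)/3] \le i < k/2$ there is a nontrivial relation $$\sum_{\substack{3 \le j \le k-1 \\ j \text{ odd}}} c_j\, \zeta(j,k-j) = 0 \qquad (c_j \in \mathbb{Q})$$ such that $c_i \ne c_{k-i}$, and $c_j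 = c_{k-j}$ for every odd integer $j$ with $[(k+5)/3] \le j < k/2$ and $j \ne i$. The number of these relations, one for each such $i$, equals $\dim M_k - 1$, and they are linearly independent over $\mathbb{Q}$. -/

import Mathlib

open scoped MatrixGroups

noncomputable section

/-- The double zeta value `ζ(q, p) = ∑_{n > m > 0} 1 / (n ^ q * m ^ p)`; the series converges
for `q ≥ 2` and `p ≥ 1`. A summation index is a pair `(n, m)`. -/
def doubleZeta (q p : ℕ) : ℝ :=
  ∑' x : {x : ℕ × ℕ // 0 < x.2 ∧ x.2 < x.1}, 1 / ((x.1.1 : ℝ) ^ q * (x.1.2 : ℝ) ^ p)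

/-- The `ℚ`-vector space spanned by the double zeta values `ζ(q, p)` of weight `q + p = k`,
with `q ≥ 2` and `p ≥ 1`. -/
def doubleZetaSpace (k : ℕ) : Submodule ℚ ℝ :=
  Submodule.span ℚ {x : ℝ | ∃ q p : ℕ, 2 ≤ q ∧ 1 ≤ p ∧ q + p = k ∧ x = doubleZeta q p}

/-- The formal symbol for `ζ(q, p)`, as an element of the free `ℚ`-vector space on the
pairs `(q, p)`. -/
def zetaSymbol (q p : ℕ) : ℕ × ℕ →₀ ℚ := Finsupp.single (q, p) 1

/-- The real number represented by a formal `ℚ`-linear combination of double zeta symbols. -/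
def zetaEval : (ℕ × ℕ →₀ ℚ) →ₗ[ℚ] ℝ :=
  Finsupp.linearCombination ℚ fun x : ℕ × ℕ => doubleZeta x.1 x.2

/-- The odd integers `j` with `a ≤ j ≤ b`. -/
def oddIcc (a b : ℕ) : Finset ℕ := (Finset.Icc a b).filter Odd

/-- The odd integers `i` with `[(k + 5) / 3] ≤ i < k / 2` (for even `k`). -/
def oddMiddle (k : ℕ) : Finset ℕ := (Finset.Ico ((k + 5) / 3) (k / 2)).filter Odd

/-- The list of linear combinations of double zeta values with odd arguments (for even `k`):
`ζ(j, k - j)` for odd `3 ≤ j ≤ [(k + 2) / 3]`, `ζ(k - j, j)` for odd `1 ≤ j ≤ [(k + 2) / 3]`, and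
`ζ(j, k - j) + ζ(k - j, j)` for odd `[(k + 5) / 3] ≤ j ≤ k / 2`. -/
def oddGenerators (k : ℕ) : Finset (ℕ × ℕ →₀ ℚ) :=
  (oddIcc 3 ((k + 2) / 3)).image (fun j => zetaSymbol j (k - j)) ∪
  (oddIcc 1 ((k + 2) / 3)).image (fun j => zetaSymbol (k - j) j) ∪
  (oddIcc ((k + 5) / 3) (k / 2)).image (fun j => zetaSymbol j (k - j) + zetaSymbol (k - j) j)

/-- The dimension of the complex vector space of modular forms of weight `k` on `SL(2, ℤ)`. -/
def dimM (k : ℕ) : ℕ := Module.finrank ℂ (ModularForm 𝒮ℒ (k : ℤ))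

end

/-! The proof is by duality. If some double zeta value of weight `k = w + 2` lay outside the span of
the generators, a `ℚ`-linear functional `φ : ℝ → ℚ` would kill the generators but not that value.
Put `g i = φ (ζ(i+1, w+1-i))`, `g 0 = 0` and `z = φ (ζ(k))`. The stuffle and shuffle products,
completed by Euler's sum formula, say that the form `G(x,y) = ∑ g i x^i y^(w-i)` satisfies `G(x,y) +
G(y,x) + z ∑ x^i y^(w-i) = G(x+y,y) + G(x+y,x)`.

Even indices of `g` correspond to odd arguments, so killing the generators makes the even-indexed
part of `G` antisymmetric. Evaluation at `(1,-1)` then forces `z = 0`, and Euler's evaluation of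
even zeta values makes the odd-indexed part antisymmetric too. Hence `f(x) = G(x,1)` satisfies
`f(1-x) = -f(x)`, and a count of its zeros against its degree gives `f = 0`
(`eq_zero_of_alternating_of_coeff`, `eq_zero_of_doubleShuffle`).

For (ii), a middle value `ζ(i,k-i)` is rewritten by the generators, which are symmetric at the
middle indices; the difference is a relation whose asymmetry sits only at `i`. The counts reduce to
the dimension formula for level one modular forms. -/

/-! ### Convergence of the double series -/

/-- The summand of `doubleZeta q p` at `n = a + b + 2`, `m = b + 1`. -/
noncomputable def doubleZetaTerm (q p : ℕ) (x : ℕ × ℕ) : ℝ :=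
  1 / (((x.1 : ℝ) + x.2 + 2) ^ q * ((x.2 : ℝ) + 1) ^ p)

/-- The zeta value `∑ 1 / n ^ k`. -/
noncomputable def zetaValue (k : ℕ) : ℝ := ∑' n : ℕ, 1 / ((n : ℝ) + 1) ^ k

/-- Pairs of naturals parametrize the pairs `n > m > 0` by `n = a + b + 2`, `m = b + 1`. -/
def prodEquivOrderedPairs : ℕ × ℕ ≃ {x : ℕ × ℕ // 0 < x.2 ∧ x.2 < x.1} where
  toFun x := ⟨(x.1 + x.2 + 2, x.2 + 1), by simp, by dsimp only; omega⟩
  invFun x := (x.1.1 - x.1.2 - 1, x.1.2 - 1)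
  left_inv x := by ext <;> dsimp only <;> omega
  right_inv x := by
    obtain ⟨⟨n, m⟩, h1, h2⟩ := x
    simp only at h1 h2
    ext <;> simp <;> omega

theorem HasSum.of_eq {ι : Type*} {f g : ι → ℝ} {a b : ℝ} (h : HasSum f a) (hfg : ∀ i, f i = g i)
    (hab : a = b) : HasSum g b := by
  obtain rfl : f = g := funext hfg
  exact hab ▸ h

theorem doubleZeta_eq_tsum_term (q p : ℕ) : doubleZeta q p = ∑' x, doubleZetaTerm q p x := by
  rw [doubleZeta, ← prodEquivOrderedPairs.tsum_eq]
  refine tsum_congr fun x => ?_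
  simp [prodEquivOrderedPairs, doubleZetaTerm]

/-- Decouples the two variables: the double series is dominated by a product of two convergent
series with exponent 3/2. -/
theorem sqrt_pow_three_mul_le {x y : ℝ} (hx : 0 ≤ x) (hy : 0 ≤ y) :
    √x ^ 3 * √y ^ 3 ≤ (x + y) ^ 2 * y := by
  obtain ⟨u, hu, rfl⟩ : ∃ u : ℝ, 0 ≤ u ∧ x = u ^ 2 := ⟨√x, by positivity, (Real.sq_sqrt hx).symm⟩
  obtain ⟨v, hv, rfl⟩ : ∃ v : ℝ, 0 ≤ v ∧ y = v ^ 2 := ⟨√y, by positivity, (Real.sq_sqrt hy).symm⟩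
  rw [Real.sqrt_sq hu, Real.sqrt_sq hv]
  have h : u ^ 3 * v ≤ (u ^ 2 + v ^ 2) ^ 2 := by
    have h1 : u * v ≤ u ^ 2 + v ^ 2 := by nlinarith [sq_nonneg (u - v), mul_nonneg hu hv]
    nlinarith [mul_le_mul_of_nonneg_left h1 (sq_nonneg u), sq_nonneg v,
      mul_nonneg (sq_nonneg u) (sq_nonneg v), sq_nonneg (v ^ 2)]
  calc u ^ 3 * v ^ 3 = (u ^ 3 * v) * v ^ 2 := by ring
    _ ≤ _ := by gcongr

theorem summable_one_div_sqrt_pow_three : Summable fun n : ℕ => 1 / √((n : ℝ) + 1) ^ 3 := by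
  have h := (summable_nat_add_iff 1).2
    (Real.summable_one_div_nat_rpow.2 (by norm_num : (1 : ℝ) < 3 / 2))
  refine h.congr fun n => ?_
  rw [Real.sqrt_eq_rpow, ← Real.rpow_natCast, ← Real.rpow_mul (by positivity)]
  norm_num

theorem summable_doubleZetaTerm {q p : ℕ} (hq : 2 ≤ q) (hp : 1 ≤ p) :
    Summable (doubleZetaTerm q p) := by
  refine Summable.of_nonneg_of_le (fun x => by unfold doubleZetaTerm; positivity) (fun x => ?_)
    (summable_one_div_sqrt_pow_three.mul_of_nonneg summable_one_div_sqrt_pow_three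
      (fun n => by positivity) (fun n => by positivity))
  rw [doubleZetaTerm, one_div_mul_one_div]
  apply one_div_le_one_div_of_le (by positivity)
  refine (sqrt_pow_three_mul_le (by positivity) (by positivity)).trans ?_
  have e : ((x.1 : ℝ) + 1 + (x.2 + 1)) = x.1 + x.2 + 2 := by ring
  rw [e]
  have h0 : (0 : ℝ) ≤ x.1 := by positivity
  have h0' : (0 : ℝ) ≤ x.2 := by positivity
  have h1 : ((x.1 : ℝ) + x.2 + 2) ^ 2 ≤ (x.1 + x.2 + 2) ^ q := pow_le_pow_right₀ (by linarith) hq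
  have h2 : ((x.2 : ℝ) + 1) ≤ (x.2 + 1) ^ p := le_self_pow₀ (by linarith) (by omega)
  gcongr

theorem hasSum_doubleZetaTerm {q p : ℕ} (hq : 2 ≤ q) (hp : 1 ≤ p) :
    HasSum (doubleZetaTerm q p) (doubleZeta q p) := by
  rw [doubleZeta_eq_tsum_term]
  exact (summable_doubleZetaTerm hq hp).hasSum

theorem summable_one_div_succ_pow {k : ℕ} (hk : 2 ≤ k) :
    Summable fun n : ℕ => 1 / ((n : ℝ) + 1) ^ k := by
  have h := (summable_nat_add_iff 1).2 (Real.summable_one_div_nat_pow.2 (by omega : 1 < k))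
  simpa using h

theorem hasSum_zetaValue {k : ℕ} (hk : 2 ≤ k) :
    HasSum (fun n : ℕ => 1 / ((n : ℝ) + 1) ^ k) (zetaValue k) :=
  (summable_one_div_succ_pow hk).hasSum

theorem hasSum_zetaValue_mul {r s : ℕ} (hr : 2 ≤ r) (hs : 2 ≤ s) :
    HasSum (fun x : ℕ × ℕ => 1 / ((x.1 : ℝ) + 1) ^ r * (1 / ((x.2 : ℝ) + 1) ^ s))
      (zetaValue r * zetaValue s) :=
  (hasSum_zetaValue hr).mul (hasSum_zetaValue hs)
    ((summable_one_div_succ_pow hr).mul_of_nonneg (summable_one_div_succ_pow hs)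
      (fun n => by positivity) (fun n => by positivity))

/-! ### The stuffle product -/

/-- The decomposition of pairs of naturals into those above, below and on the diagonal. -/
noncomputable def trichotomyEquiv : (ℕ × ℕ) ⊕ ((ℕ × ℕ) ⊕ ℕ) ≃ ℕ × ℕ :=
  Equiv.ofBijective
    (Sum.elim (fun x => (x.1 + x.2 + 1, x.2))
      (Sum.elim (fun x => (x.2, x.1 + x.2 + 1)) (fun n => (n, n)))) <| by
    constructor
    · rintro (⟨a, b⟩ | ⟨a, b⟩ | a) (⟨c, d⟩ | ⟨c, d⟩ | c) <;> simp <;> omega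
    · rintro ⟨a, b⟩
      rcases lt_trichotomy a b with h | rfl | h
      · exact ⟨Sum.inr (Sum.inl (b - a - 1, a)), by simp; omega⟩
      · exact ⟨Sum.inr (Sum.inr a), by simp⟩
      · exact ⟨Sum.inl (a - b - 1, b), by simp; omega⟩

/-- The stuffle product of zeta values. -/
theorem zetaValue_mul_eq_stuffle {r s : ℕ} (hr : 2 ≤ r) (hs : 2 ≤ s) :
    zetaValue r * zetaValue s = doubleZeta r s + doubleZeta s r + zetaValue (r + s) := by
  have h := trichotomyEquiv.hasSum_iff.2 (hasSum_zetaValue_mul hr hs)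
  refine h.unique ?_
  rw [add_assoc]
  refine HasSum.sum ?_ (HasSum.sum ?_ ?_)
  · refine (hasSum_doubleZetaTerm hr (by omega : 1 ≤ s)).of_eq (fun x => ?_) rfl
    change doubleZetaTerm r s x =
      1 / (((x.1 + x.2 + 1 : ℕ) : ℝ) + 1) ^ r * (1 / ((x.2 : ℝ) + 1) ^ s)
    rw [doubleZetaTerm, one_div_mul_one_div]
    push_cast
    ring_nf
  · refine (hasSum_doubleZetaTerm hs (by omega : 1 ≤ r)).of_eq (fun x => ?_) rfl
    change doubleZetaTerm s r x =
      1 / ((x.2 : ℝ) + 1) ^ r * (1 / (((x.1 + x.2 + 1 : ℕ) : ℝ) + 1) ^ s)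
    rw [doubleZetaTerm, one_div_mul_one_div]
    push_cast
    ring_nf
  · refine (hasSum_zetaValue (by omega : 2 ≤ r + s)).of_eq (fun n => ?_) rfl
    change 1 / ((n : ℝ) + 1) ^ (r + s) = 1 / ((n : ℝ) + 1) ^ r * (1 / ((n : ℝ) + 1) ^ s)
    rw [one_div_mul_one_div, pow_add]

/-! ### Partial fractions and the shuffle product -/

/-- The part of the partial fraction expansion of `x ^ (-(r + 1)) * y ^ (-(s + 1))`, written in
`Y = y⁻¹` and `u = (x + y)⁻¹`, that has poles at `y = 0` and `x + y = 0`. -/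
noncomputable def partialFractionPart (u Y : ℝ) (r w : ℕ) : ℝ :=
  ∑ a ∈ Finset.range (w + 1), (a.choose r : ℝ) * (u ^ (a + 1) * Y ^ (w - a + 1))

theorem partialFractionPart_succ (u Y : ℝ) (r w : ℕ) :
    partialFractionPart u Y (r + 1) (w + 1) =
      u * (partialFractionPart u Y r w + partialFractionPart u Y (r + 1) w) := by
  unfold partialFractionPart
  rw [Finset.sum_range_succ', ← Finset.sum_add_distrib, Finset.mul_sum]
  simp only [Nat.choose_zero_succ, Nat.cast_zero, zero_mul, add_zero]
  refine Finset.sum_congr rfl fun a _ => ?_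
  rw [Nat.choose_succ_succ, Nat.add_sub_add_right]
  push_cast
  ring

theorem partialFractionPart_zero_succ (u Y : ℝ) (w : ℕ) :
    partialFractionPart u Y 0 (w + 1) = Y * partialFractionPart u Y 0 w + u ^ (w + 2) * Y := by
  unfold partialFractionPart
  rw [Finset.sum_range_succ, Finset.mul_sum]
  simp only [Nat.choose_zero_right, Nat.cast_one, one_mul, Nat.sub_self]
  congr 1
  · refine Finset.sum_congr rfl fun a ha => ?_
    have : w + 1 - a = w - a + 1 := by have := Finset.mem_range.1 ha; omega
    rw [this]
    ring
  · ring

theorem partialFractionPart_self (u Y : ℝ) (w : ℕ) :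
    partialFractionPart u Y w w = u ^ (w + 1) * Y := by
  unfold partialFractionPart
  rw [Finset.sum_range_succ, Finset.sum_eq_zero]
  · simp
  · intro a ha
    simp [Nat.choose_eq_zero_of_lt (Finset.mem_range.1 ha)]

theorem partialFraction_zero {u X Y : ℝ} (h : X * Y = u * (X + Y)) (s : ℕ) :
    X * Y ^ (s + 1) = partialFractionPart u Y 0 s + partialFractionPart u X s s := by
  rw [partialFractionPart_self]
  induction s with
  | zero => simp [partialFractionPart]; linarith
  | succ s ih =>
    rw [partialFractionPart_zero_succ]
    have : X * Y ^ (s + 1 + 1) = Y * (X * Y ^ (s + 1)) := by ring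
    rw [this, ih]
    linear_combination u ^ (s + 1) * h

/-- Induction on the weight: `X * Y = u * (X + Y)` trades a monomial for `u` times two monomials of
lower weight, and the coefficients follow Pascal's rule. -/
theorem partialFraction {u X Y : ℝ} (h : X * Y = u * (X + Y)) (r s : ℕ) :
    X ^ (r + 1) * Y ^ (s + 1) =
      partialFractionPart u Y r (r + s) + partialFractionPart u X s (r + s) := by
  have key : ∀ w r s, r + s = w → X ^ (r + 1) * Y ^ (s + 1) =
      partialFractionPart u Y r w + partialFractionPart u X s w := by
    intro w
    induction w with
    | zero =>
      intro r s hw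
      obtain ⟨rfl, rfl⟩ : r = 0 ∧ s = 0 := by omega
      simpa using partialFraction_zero h 0
    | succ w ih =>
      intro r s hw
      rcases r with _ | r
      · obtain rfl : s = w + 1 := by omega
        simpa using partialFraction_zero h (w + 1)
      rcases s with _ | s
      · obtain rfl : r = w := by omega
        have := partialFraction_zero (X := Y) (Y := X) (u := u) (by linarith) (r + 1)
        simp only [zero_add, pow_one]
        linarith
      rw [partialFractionPart_succ, partialFractionPart_succ]
      have h1 := ih r (s + 1) (by omega)
      have h2 := ih (r + 1) s (by omega)
      have : X ^ (r + 1 + 1) * Y ^ (s + 1 + 1) =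
          u * (X ^ (r + 1) * Y ^ (s + 1 + 1) + X ^ (r + 1 + 1) * Y ^ (s + 1)) := by
        linear_combination X ^ (r + 1) * Y ^ (s + 1) * h
      rw [this, h1, h2]
      ring
  exact key _ r s rfl

theorem one_div_mul_one_div_eq {x y : ℝ} (hx : 0 < x) (hy : 0 < y) :
    (1 / x) * (1 / y) = 1 / (x + y) * (1 / x + 1 / y) := by
  field_simp
  ring

theorem doubleZetaTerm_eq (q p : ℕ) (x : ℕ × ℕ) :
    doubleZetaTerm q p x = (1 / ((x.1 : ℝ) + 1 + (x.2 + 1))) ^ q * (1 / ((x.2 : ℝ) + 1)) ^ p := by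
  rw [doubleZetaTerm, one_div_pow, one_div_pow, one_div_mul_one_div]
  ring_nf

theorem hasSum_partialFractionPart {r w : ℕ} (hr : 1 ≤ r) :
    HasSum (fun x : ℕ × ℕ => partialFractionPart (1 / ((x.1 : ℝ) + 1 + (x.2 + 1)))
        (1 / ((x.2 : ℝ) + 1)) r w)
      (∑ a ∈ Finset.range (w + 1), (a.choose r : ℝ) * doubleZeta (a + 1) (w - a + 1)) := by
  unfold partialFractionPart
  refine hasSum_sum fun a _ => ?_
  rcases Nat.lt_or_ge a r with h | h
  · simp [Nat.choose_eq_zero_of_lt h]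
  · refine HasSum.mul_left _ ?_
    exact (hasSum_doubleZetaTerm (by omega) (by omega)).of_eq (fun x => doubleZetaTerm_eq _ _ x) rfl

/-- The shuffle product of zeta values. -/
theorem zetaValue_mul_eq_shuffle {r s : ℕ} (hr : 1 ≤ r) (hs : 1 ≤ s) :
    zetaValue (r + 1) * zetaValue (s + 1) =
      ∑ a ∈ Finset.range (r + s + 1),
        ((a.choose r : ℝ) + a.choose s) * doubleZeta (a + 1) (r + s - a + 1) := by
  refine (hasSum_zetaValue_mul (by omega) (by omega)).unique ?_
  have h1 := hasSum_partialFractionPart (w := r + s) hr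
  have h2 := (Equiv.prodComm ℕ ℕ).hasSum_iff.2 (hasSum_partialFractionPart (w := r + s) hs)
  convert! h1.add h2 using 1
  · ext x
    have := partialFraction (one_div_mul_one_div_eq (x := (x.1 : ℝ) + 1) (y := (x.2 : ℝ) + 1)
      (by positivity) (by positivity)) r s
    simp only [one_div_pow] at this
    rw [this]
    simp [add_comm]
  · rw [← Finset.sum_add_distrib]
    exact Finset.sum_congr rfl fun a _ => by ring

/-! ### Euler's sum formula -/

theorem hasSum_one_div_sub_one_div (y : ℕ) :
    HasSum (fun x : ℕ => 1 / ((x : ℝ) + 1) - 1 / ((x : ℝ) + 1 + y))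
      (∑ i ∈ Finset.range y, 1 / ((i : ℝ) + 1)) := by
  induction y with
  | zero => simp
  | succ y ih =>
    rw [Finset.sum_range_succ]
    have h : HasSum (fun x : ℕ => 1 / ((x : ℝ) + 1 + y) - 1 / ((x : ℝ) + 1 + y + 1))
        (1 / ((y : ℝ) + 1)) := by
      rw [hasSum_iff_tendsto_nat_of_nonneg]
      · have h2 : ∀ n : ℕ, ∑ x ∈ Finset.range n,
            (1 / ((x : ℝ) + 1 + y) - 1 / ((x : ℝ) + 1 + y + 1)) =
              1 / ((y : ℝ) + 1) - 1 / ((n : ℝ) + (y + 1)) := by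
          intro n
          have := Finset.sum_range_sub' (fun x : ℕ => 1 / ((x : ℝ) + 1 + y)) n
          simp only [Nat.cast_add, Nat.cast_one, Nat.cast_zero] at this
          rw [zero_add, add_assoc (n : ℝ), add_comm (1 : ℝ) (y : ℝ)] at this
          rw [← this]
          refine Finset.sum_congr rfl fun x _ => by ring
        simp only [h2]
        have h3 : Filter.Tendsto (fun n : ℕ => 1 / ((n : ℝ) + (y + 1))) Filter.atTop (nhds 0) := by
          simp only [one_div]
          exact (Filter.tendsto_atTop_add_const_right _ _
            tendsto_natCast_atTop_atTop).inv_tendsto_atTop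
        simpa using tendsto_const_nhds.sub h3
      · intro x
        rw [sub_nonneg]
        exact one_div_le_one_div_of_le (by positivity) (by linarith)
    refine (ih.add h).of_eq (fun x => ?_) rfl
    push_cast
    ring

theorem hasSum_harmonic_div_pow {k : ℕ} (hk : 2 ≤ k) :
    HasSum (fun b : ℕ => (∑ i ∈ Finset.range (b + 1), 1 / ((i : ℝ) + 1)) * (1 / ((b : ℝ) + 1) ^ k))
      (doubleZeta k 1 + zetaValue (k + 1)) := by
  have h1 : HasSum (fun n : ℕ =>
      (∑ i ∈ Finset.range (n + 1), 1 / ((i : ℝ) + 1)) * (1 / (((n + 1 : ℕ) : ℝ) + 1) ^ k))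
      (doubleZeta k 1) := by
    -- The antidiagonal `a + b = n` fixes the larger summation index `n + 2`; the inner sum over the
    -- smaller one is a harmonic number.
    have h := Finset.HasAntidiagonal.sigmaAntidiagonalEquivProd.hasSum_iff.2
      (hasSum_doubleZetaTerm hk le_rfl)
    refine h.sigma fun n => ?_
    refine (hasSum_fintype _).of_eq (fun _ => rfl)
      (Eq.trans (Finset.sum_coe_sort _ (doubleZetaTerm k 1)) ?_)
    rw [Finset.sum_mul, Finset.Nat.sum_antidiagonal_eq_sum_range_succ_mk,
      ← Finset.sum_range_reflect]
    refine Finset.sum_congr rfl fun i hi => ?_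
    have hi' : i ≤ n := by have := Finset.mem_range.1 hi; omega
    simp only [doubleZetaTerm, pow_one, one_div_mul_one_div]
    rw [show n.succ - 1 - i = n - i by omega, show n - (n - i) = i by omega, Nat.cast_sub hi']
    push_cast
    ring_nf
  have h2 := (hasSum_nat_add_iff (f := fun n : ℕ =>
    (∑ i ∈ Finset.range n, 1 / ((i : ℝ) + 1)) * (1 / ((n : ℝ) + 1) ^ k)) 1).1 h1
  simp only [Finset.range_one, Finset.sum_singleton, Finset.range_zero, Finset.sum_empty, zero_mul,
    add_zero] at h2
  refine (h2.add (hasSum_zetaValue (by omega : 2 ≤ k + 1))).of_eq (fun b => ?_) rfl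
  rw [Finset.sum_range_succ, add_mul, one_div_mul_one_div, pow_succ']

/-- Euler's sum formula. -/
theorem sum_doubleZeta_eq_zetaValue {w : ℕ} (hw : 1 ≤ w) :
    ∑ a ∈ Finset.range w, doubleZeta (a + 2) (w - a) = zetaValue (w + 2) := by
  have hA : HasSum (fun x : ℕ × ℕ => ∑ a ∈ Finset.range w, doubleZetaTerm (a + 2) (w - a) x)
      (∑ a ∈ Finset.range w, doubleZeta (a + 2) (w - a)) :=
    hasSum_sum fun a ha =>
      hasSum_doubleZetaTerm (by omega) (by have := Finset.mem_range.1 ha; omega)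
  have hB := (Equiv.prodComm ℕ ℕ).hasSum_iff.2
    (hasSum_doubleZetaTerm (q := w + 1) (p := 1) (by omega) le_rfl)
  have hC := (Equiv.prodComm ℕ ℕ).hasSum_iff.2 (hA.add hB)
  -- The expansion of `X * Y ^ (w + 1)` cannot be summed termwise, since its term `u * Y ^ (w + 1)`
  -- diverges. Moving that term to the left gives `(X - u) * Y ^ (w + 1)`, which telescopes in `x`.
  -- Both sides then contain `ζ(w+1,1)`, which cancels.
  have hD := hC.prod_fiberwise (g := fun b : ℕ =>
    (∑ i ∈ Finset.range (b + 1), 1 / ((i : ℝ) + 1)) * (1 / ((b : ℝ) + 1) ^ (w + 1))) ?_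
  · have := hD.unique (hasSum_harmonic_div_pow (by omega))
    linarith
  intro b
  refine ((hasSum_one_div_sub_one_div (b + 1)).mul_right (1 / ((b : ℝ) + 1) ^ (w + 1))).of_eq
    (fun x => ?_) rfl
  simp only [Function.comp, Equiv.prodComm_apply, Prod.swap_prod_mk, doubleZetaTerm_eq]
  set X : ℝ := 1 / ((x : ℝ) + 1) with hX
  set Y : ℝ := 1 / ((b : ℝ) + 1) with hY
  set u : ℝ := 1 / ((x : ℝ) + 1 + (b + 1)) with hu
  have hXY : X * Y = u * (X + Y) :=
    one_div_mul_one_div_eq (x := (x : ℝ) + 1) (y := (b : ℝ) + 1) (by positivity) (by positivity)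
  have h := partialFraction_zero hXY w
  have hu' : 1 / ((b : ℝ) + 1 + (x + 1)) = u := by rw [hu, add_comm]
  rw [partialFractionPart_self] at h
  unfold partialFractionPart at h
  rw [Finset.sum_range_succ'] at h
  simp only [Nat.choose_zero_right, Nat.cast_one, one_mul, Nat.sub_zero, zero_add, pow_one] at h
  have e : ∑ a ∈ Finset.range w, u ^ (a + 1 + 1) * Y ^ (w - (a + 1) + 1) =
      ∑ a ∈ Finset.range w, u ^ (a + 2) * Y ^ (w - a) := by
    refine Finset.sum_congr rfl fun a ha => ?_
    have := Finset.mem_range.1 ha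
    rw [show w - (a + 1) + 1 = w - a by omega]
  rw [e] at h
  have hb : 1 / ((x : ℝ) + 1 + ((b + 1 : ℕ) : ℝ)) = u := by rw [hu]; push_cast; rfl
  rw [hu', hb, ← one_div_pow, ← hY]
  linear_combination h

/-! ### Even zeta values -/

/-- The product of two even zeta values is a rational multiple of the zeta value of their total
weight. -/
theorem exists_rat_zetaValue_mul {r s : ℕ} (hr : Even r) (hs : Even s) (hr2 : 2 ≤ r) (hs2 : 2 ≤ s) :
    ∃ c : ℚ, zetaValue r * zetaValue s = c * zetaValue (r + s) := by
  have key : ∀ k : ℕ, Even k → 2 ≤ k → ∃ c : ℚ, zetaValue k = c * Real.pi ^ k := by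
    intro k hk hk2
    obtain ⟨n, rfl⟩ := hk.two_dvd
    have h := hasSum_zeta_nat (k := n) (by omega)
    rw [← hasSum_nat_add_iff' 1] at h
    have h' := (hasSum_zetaValue hk2).unique (by simpa using h)
    refine ⟨(-1) ^ (n + 1) * 2 ^ (2 * n - 1) * bernoulli (2 * n) / (2 * n).factorial, ?_⟩
    rw [h']
    push_cast
    simp [show n ≠ 0 by omega]
    ring
  obtain ⟨a, ha⟩ := key r hr hr2
  obtain ⟨b, hb⟩ := key s hs hs2
  obtain ⟨c, hc⟩ := key (r + s) (hr.add hs) (by omega)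
  have hpos : 0 < zetaValue (r + s) :=
    (summable_one_div_succ_pow (by omega)).tsum_pos (fun n => by positivity) 0 (by simp)
  have hc0 : (c : ℝ) ≠ 0 := by
    rintro h
    rw [hc, h, zero_mul] at hpos
    exact hpos.false
  refine ⟨a * b / c, ?_⟩
  rw [ha, hb, hc]
  push_cast
  rw [pow_add]
  field_simp
-- Polynomials alternating under `x ↦ 1 - x`
open Polynomial in
theorem coeff_comp_one_sub_X (f : ℚ[X]) (i : ℕ) :
    (f.comp (1 - X)).coeff i = (hasseDeriv i f).eval 1 * (-1) ^ i := by
  have : f.comp (1 - X) = (taylor 1 f).comp (C (-1) * X) := by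
    rw [taylor_apply, comp_assoc]
    congr 1
    simp
    ring
  rw [this, comp_C_mul_X_coeff, taylor_coeff]

open Polynomial in
/-- A polynomial alternating under `x ↦ 1 - x` has odd degree, and its second coefficient is
proportional to the leading one. -/
theorem two_mul_coeff_natDegree_sub_one {f : ℚ[X]} (hf : f ≠ 0) (h : f.comp (1 - X) = -f) :
    Odd f.natDegree ∧
      2 * f.coeff (f.natDegree - 1) = -(f.natDegree : ℚ) * f.coeff f.natDegree := by
  set d := f.natDegree with hd
  have hlead : f.coeff d ≠ 0 := by simpa [hd] using hf
  have hodd : Odd d := by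
    by_contra hev
    rw [Nat.not_odd_iff_even] at hev
    have h1 := coeff_comp_one_sub_X f d
    rw [h, hev.neg_one_pow, hd, hasseDeriv_natDegree_eq_C, eval_C, coeff_neg, mul_one,
      ← coeff_natDegree, ← hd] at h1
    apply hlead
    linarith
  refine ⟨hodd, ?_⟩
  have hd1 : 1 ≤ d := hodd.pos
  have h1 := coeff_comp_one_sub_X f (d - 1)
  have hev : Even (d - 1) := Nat.Odd.sub_odd hodd odd_one
  rw [h, hev.neg_one_pow, mul_one, coeff_neg, eval_eq_sum_range' (n := 2)] at h1
  · simp only [Finset.sum_range_succ, Finset.range_zero, Finset.sum_empty, hasseDeriv_coeff,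
      one_pow, mul_one, zero_add] at h1
    rw [show 1 + (d - 1) = d by omega, Nat.choose_self, Nat.choose_symm hd1, Nat.choose_one_right,
      Nat.cast_one] at h1
    linarith
  · have := natDegree_hasseDeriv_le f (d - 1)
    omega

-- The degree `d` is odd and the coefficient at the even index `d - 1` is nonzero, so the vanishing
-- of outer even coefficients pushes `d` down to `w - M`, where `M = [(w+1)/3]`. Antisymmetry turns
-- this into a zero of order `M` at 0, hence also at 1; with the zeros at -1 and 2 there are too
-- many.
open Polynomial in
theorem eq_zero_of_alternating_of_coeff {f : ℚ[X]} {w : ℕ} (h : f.comp (1 - X) = -f)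
    (hneg : f.eval (-1) = 0) (htwo : f.eval 2 = 0)
    (hlow : ∀ n, Even n → 3 * n ≤ w + 1 → f.coeff n = 0)
    (hsymm : ∀ n, n ≤ w → f.coeff (w - n) = -f.coeff n) (hdeg : f.natDegree ≤ w)
    (hw : Even w) : f = 0 := by
  by_contra hf
  obtain ⟨hodd, hcoeff⟩ := two_mul_coeff_natDegree_sub_one hf h
  set d := f.natDegree with hd
  have hlead : f.coeff d ≠ 0 := by simpa [hd] using hf
  have hd1 : 1 ≤ d := hodd.pos
  obtain ⟨M, hM1, hM2⟩ : ∃ M, 3 * M ≤ w + 1 ∧ w + 1 < 3 * M + 3 :=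
    ⟨(w + 1) / 3, by omega, by omega⟩
  have hev : Even (d - 1) := Nat.Odd.sub_odd hodd odd_one
  have hne : f.coeff (d - 1) ≠ 0 := by
    intro h0
    rw [h0] at hcoeff
    have : (d : ℚ) ≠ 0 := by exact_mod_cast (by omega : d ≠ 0)
    exact mul_ne_zero (neg_ne_zero.2 this) hlead (by linarith)
  -- Otherwise the mirror index `w - (d - 1)` is even and at most `M`, so its coefficient vanishes,
  -- and with it the one at `d - 1`.
  have hdM : d + M ≤ w := by
    by_contra hcon
    have h1 := hsymm (d - 1) (by omega)
    rw [hlow (w - (d - 1)) ((Nat.even_sub (by omega)).2 (by tauto)) (by omega)] at h1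
    exact hne (by linarith)
  have hX : X ^ M ∣ f := by
    rw [X_pow_dvd_iff]
    intro n hn
    have h1 := hsymm n (by omega)
    rw [coeff_eq_zero_of_natDegree_lt (by omega)] at h1
    linarith
  have hX1 : (X - C (1 : ℚ)) ^ M ∣ f := by
    obtain ⟨g, hg⟩ := hX
    have h1 : f = -((1 - X) ^ M * g.comp (1 - X)) := by
      rw [← neg_eq_iff_eq_neg, ← h, hg]
      simp
    rw [h1, dvd_neg]
    refine Dvd.dvd.mul_right (pow_dvd_pow_of_dvd ⟨-1, ?_⟩ M) _
    simp
  have hm1 : (X - C (-1 : ℚ)) ∣ f := dvd_iff_isRoot.2 hneg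
  have h2 : (X - C (2 : ℚ)) ∣ f := dvd_iff_isRoot.2 htwo
  have cop : ∀ a b : ℚ, a ≠ b → IsCoprime (X - C a) (X - C b) := fun a b hab =>
    pairwise_coprime_X_sub_C Function.injective_id hab
  have hX' : (X - C (0 : ℚ)) ^ M ∣ f := by simpa using hX
  have hall : (X - C (0 : ℚ)) ^ M * (X - C (1 : ℚ)) ^ M * ((X - C (-1 : ℚ)) * (X - C (2 : ℚ))) ∣ f := by
    refine IsCoprime.mul_dvd ?_ ((cop 0 1 (by norm_num)).pow.mul_dvd hX' hX1)
      ((cop (-1) 2 (by norm_num)).mul_dvd hm1 h2)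
    refine IsCoprime.mul_left (IsCoprime.pow_left ?_) (IsCoprime.pow_left ?_) <;>
    exact IsCoprime.mul_right (cop _ _ (by norm_num)) (cop _ _ (by norm_num))
  -- This yields `2 * M + 2 ≤ d ≤ w - M`, against `w + 1 < 3 * M + 3`.
  have hle := natDegree_le_of_dvd hall hf
  have hmon : ∀ a : ℚ, (X - C a) ≠ 0 := fun a => X_sub_C_ne_zero a
  rw [natDegree_mul (mul_ne_zero (pow_ne_zero _ (hmon _)) (pow_ne_zero _ (hmon _)))
    (mul_ne_zero (hmon _) (hmon _)), natDegree_mul (pow_ne_zero _ (hmon _)) (pow_ne_zero _ (hmon _)),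
    natDegree_mul (hmon _) (hmon _), natDegree_pow, natDegree_pow] at hle
  simp only [natDegree_X_sub_C] at hle
  omega

/-! ### The double shuffle relations as a functional equation of binary forms -/

theorem neg_one_pow_sub_of_even {w i : ℕ} (hw : Even w) (hi : i ≤ w) :
    (-1 : ℚ) ^ (w - i) = (-1) ^ i := by
  rcases Nat.even_or_odd i with h | h
  · rw [h.neg_one_pow, ((Nat.even_sub hi).2 (by tauto)).neg_one_pow]
  · rw [h.neg_one_pow, (Nat.Even.sub_odd hi hw h).neg_one_pow]

/-- The binary form with coefficients `g`. -/
def binaryForm (g : ℕ → ℚ) (w : ℕ) (x y : ℚ) : ℚ :=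
  ∑ i ∈ Finset.range (w + 1), g i * (x ^ i * y ^ (w - i))

theorem binaryForm_swap (g : ℕ → ℚ) (w : ℕ) (x y : ℚ) :
    binaryForm (fun i => g (w - i)) w x y = binaryForm g w y x := by
  unfold binaryForm
  rw [← Finset.sum_range_reflect]
  refine Finset.sum_congr rfl fun i hi => ?_
  have : i ≤ w := by have := Finset.mem_range.1 hi; omega
  simp only [Nat.add_sub_cancel]
  rw [show w - (w - i) = i by omega]
  ring

theorem binaryForm_add_left (g : ℕ → ℚ) (w : ℕ) (x y : ℚ) :
    binaryForm (fun i => ∑ a ∈ Finset.range (w + 1), (a.choose i : ℚ) * g a) w x y =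
      binaryForm g w (x + y) y := by
  unfold binaryForm
  simp only [Finset.sum_mul]
  rw [Finset.sum_comm]
  refine Finset.sum_congr rfl fun a ha => ?_
  have ha' : a ≤ w := by have := Finset.mem_range.1 ha; omega
  rw [add_pow, ← Finset.sum_subset (Finset.range_mono (by omega : a + 1 ≤ w + 1)), Finset.sum_mul,
    Finset.mul_sum]
  · refine Finset.sum_congr rfl fun i hi => ?_
    have hi' : i ≤ a := by have := Finset.mem_range.1 hi; omega
    rw [show w - i = (a - i) + (w - a) by omega, pow_add]
    ring
  · intro i _ hi
    rw [Nat.choose_eq_zero_of_lt (by simpa using hi)]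
    simp

/-- Coefficient families of even weight `w` satisfying the double shuffle relations of
double zeta values modulo products, and whose odd-odd symmetrizations and outer odd-odd entries
vanish, are zero. -/
theorem eq_zero_of_doubleShuffle {g : ℕ → ℚ} {z : ℚ} {w : ℕ} (hw : Even w) (hw2 : 2 ≤ w)
    (hds : ∀ i ≤ w, g i + g (w - i) + z =
      ∑ a ∈ Finset.range (w + 1), ((a.choose i : ℚ) + a.choose (w - i)) * g a)
    (hodd : z = 0 → ∀ i ≤ w, Odd i → g i + g (w - i) = 0)
    (hev : ∀ i ≤ w, Even i → g i + g (w - i) = 0)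
    (hlow : ∀ i, Even i → 3 * i ≤ w + 1 → g i = 0) : ∀ i ≤ w, g i = 0 := by
  have hform : ∀ x y : ℚ, binaryForm g w x y + binaryForm g w y x + binaryForm (fun _ => z) w x y =
      binaryForm g w (x + y) y + binaryForm g w (x + y) x := by
    intro x y
    rw [← binaryForm_swap g w x y, ← binaryForm_add_left g w x y]
    conv_rhs => rw [add_comm x y, ← binaryForm_add_left g w y x,
      ← binaryForm_swap _ w x y]
    unfold binaryForm
    simp only [← Finset.sum_add_distrib, ← add_mul]
    refine Finset.sum_congr rfl fun i hi => ?_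
    rw [hds i (by have := Finset.mem_range.1 hi; omega)]
  have hg0 : g 0 = 0 := hlow 0 (by simp) (by omega)
  have hsum : z = ∑ a ∈ Finset.range (w + 1), g a := by
    have h1 := hds 0 (by omega)
    simp only [Nat.choose_zero_right, Nat.cast_one, Nat.sub_zero, add_mul, one_mul, hg0,
      Finset.sum_add_distrib] at h1
    have h2 : ∑ a ∈ Finset.range (w + 1), (a.choose w : ℚ) * g a = g w := by
      rw [Finset.sum_range_succ, Finset.sum_eq_zero, Nat.choose_self, Nat.cast_one, one_mul,
        zero_add]
      intro a ha
      simp [Nat.choose_eq_zero_of_lt (Finset.mem_range.1 ha)]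
    linarith
  have heven : ∑ i ∈ Finset.range (w + 1), (1 + (-1) ^ i) * g i = 0 := by
    have h1 := Finset.sum_range_reflect (fun i => (1 + (-1) ^ i) * g i) (w + 1)
    have h2 : ∑ i ∈ Finset.range (w + 1), (1 + (-1) ^ i) * (g i + g (w - i)) = 0 := by
      refine Finset.sum_eq_zero fun i hi => ?_
      rcases Nat.even_or_odd i with h | h
      · rw [hev i (by have := Finset.mem_range.1 hi; omega) h, mul_zero]
      · simp [h.neg_one_pow]
    simp only [mul_add, Finset.sum_add_distrib] at h2
    have h3 : ∑ i ∈ Finset.range (w + 1), (1 + (-1) ^ (w + 1 - 1 - i)) * g (w + 1 - 1 - i) =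
        ∑ i ∈ Finset.range (w + 1), (1 + (-1) ^ i) * g (w - i) := by
      refine Finset.sum_congr rfl fun i hi => ?_
      rw [Nat.add_sub_cancel, neg_one_pow_sub_of_even hw (by have := Finset.mem_range.1 hi; omega)]
    rw [h3] at h1
    linarith
  -- At `(1,-1)` the right side vanishes because `g 0 = 0`, so `2 ∑ (-1)^i g i + z = 0`. By `heven`
  -- and `hsum` the alternating sum is `-z`, whence `-2z + z = 0`.
  have hz : z = 0 := by
    have h1 := hform 1 (-1)
    have h2 : ∀ y, binaryForm g w 0 y = 0 := by
      intro y
      refine Finset.sum_eq_zero fun i _ => ?_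
      rcases Nat.eq_zero_or_pos i with rfl | hi
      · simp [hg0]
      · simp [hi.ne']
    have h3 : ∀ c : ℕ → ℚ, binaryForm c w 1 (-1) = ∑ i ∈ Finset.range (w + 1), (-1) ^ i * c i := by
      intro c
      refine Finset.sum_congr rfl fun i hi => ?_
      rw [neg_one_pow_sub_of_even hw (by have := Finset.mem_range.1 hi; omega)]
      ring
    have h4 : binaryForm g w (-1) 1 = ∑ i ∈ Finset.range (w + 1), (-1) ^ i * g i := by
      refine Finset.sum_congr rfl fun i hi => ?_
      ring
    have h5 : ∑ i ∈ Finset.range (w + 1), (-1 : ℚ) ^ i * z = z := by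
      rw [← Finset.sum_mul, geom_sum_eq (by norm_num), hw.add_one.neg_one_pow]
      norm_num
    rw [add_neg_cancel, h2, h2, h3, h3, h4, h5] at h1
    simp only [add_mul, one_mul, Finset.sum_add_distrib] at heven
    linarith
  have hanti : ∀ i ≤ w, g (w - i) = -g i := by
    intro i hi
    rcases Nat.even_or_odd i with h | h
    · linarith [hev i hi h]
    · linarith [hodd hz i hi h]
  have hswap : ∀ x y, binaryForm g w y x = -binaryForm g w x y := by
    intro x y
    rw [← binaryForm_swap]
    unfold binaryForm
    rw [← Finset.sum_neg_distrib]
    refine Finset.sum_congr rfl fun i hi => ?_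
    dsimp only
    rw [hanti i (by have := Finset.mem_range.1 hi; omega)]
    ring
  have hadd : ∀ x y, binaryForm g w (x + y) x = -binaryForm g w (x + y) y := by
    intro x y
    have h1 := hform x y
    have h2 : binaryForm (fun _ => z) w x y = 0 := by simp [binaryForm, hz]
    rw [h2, hswap x y] at h1
    linarith
  have hneg : ∀ x y, binaryForm g w (-x) (-y) = binaryForm g w x y := by
    intro x y
    unfold binaryForm
    refine Finset.sum_congr rfl fun i hi => ?_
    have hi' : i ≤ w := by have := Finset.mem_range.1 hi; omega
    rw [neg_pow x, neg_pow y, mul_mul_mul_comm, ← pow_add, Nat.add_sub_cancel' hi', hw.neg_one_pow,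
      one_mul]
  let f : Polynomial ℚ := ∑ i ∈ Finset.range (w + 1), Polynomial.monomial i (g i)
  have hcoeff : ∀ n, f.coeff n = if n ≤ w then g n else 0 := by
    intro n
    simp [f, Polynomial.finsetSum_coeff, Polynomial.coeff_monomial]
  have heval : ∀ x, f.eval x = binaryForm g w x 1 := by
    intro x
    simp [f, Polynomial.eval_finsetSum, binaryForm]
  -- Swapping the arguments of `G(-1,1)` changes its sign, while negating both does not, as `w` is
  -- even.
  have hm1 : f.eval (-1) = 0 := by
    rw [heval]
    have h1 := hswap (-1) 1
    have h2 := hneg (-1) 1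
    rw [neg_neg] at h2
    linarith
  have hcomp : f.comp (1 - Polynomial.X) = -f := by
    refine Polynomial.funext fun x => ?_
    simp only [Polynomial.eval_comp, Polynomial.eval_sub, Polynomial.eval_one, Polynomial.eval_X,
      Polynomial.eval_neg, heval]
    have h1 := hadd (1 - x) x
    rw [sub_add_cancel] at h1
    rw [hswap 1 (1 - x), hswap 1 x]
    linarith
  have hf : f = 0 := by
    refine eq_zero_of_alternating_of_coeff (w := w) hcomp hm1 ?_ ?_ ?_ ?_ hw
    · have := congrArg (Polynomial.eval 2) hcomp
      simp only [Polynomial.eval_comp, Polynomial.eval_sub, Polynomial.eval_one, Polynomial.eval_X,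
        Polynomial.eval_neg] at this
      norm_num [hm1] at this
      linarith
    · intro n hn hn3
      rw [hcoeff, hlow n hn hn3, ite_self]
    · intro n hn
      rw [hcoeff, hcoeff, if_pos hn, if_pos (by omega), hanti n hn]
    · rw [Polynomial.natDegree_le_iff_coeff_eq_zero]
      intro n hn
      rw [hcoeff, if_neg (by omega)]
  intro i hi
  have := hcoeff i
  rw [hf, if_pos hi] at this
  simpa using this.symm

/-! ### Generation of the double zeta space -/

theorem mem_oddIcc {a b j : ℕ} : j ∈ oddIcc a b ↔ (a ≤ j ∧ j ≤ b) ∧ Odd j := by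
  simp [oddIcc]

theorem mem_oddMiddle {k j : ℕ} : j ∈ oddMiddle k ↔ ((k + 5) / 3 ≤ j ∧ j < k / 2) ∧ Odd j := by
  simp [oddMiddle]

@[simp]
theorem zetaEval_zetaSymbol (q p : ℕ) : zetaEval (zetaSymbol q p) = doubleZeta q p := by
  simp [zetaEval, zetaSymbol]

theorem mem_oddGenerators {k : ℕ} {x : ℕ × ℕ →₀ ℚ} : x ∈ oddGenerators k ↔
    (∃ j ∈ oddIcc 3 ((k + 2) / 3), zetaSymbol j (k - j) = x) ∨
    (∃ j ∈ oddIcc 1 ((k + 2) / 3), zetaSymbol (k - j) j = x) ∨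
    ∃ j ∈ oddIcc ((k + 5) / 3) (k / 2), zetaSymbol j (k - j) + zetaSymbol (k - j) j = x := by
  simp only [oddGenerators, Finset.mem_union, Finset.mem_image, or_assoc]

theorem span_zetaEval_oddGenerators_le (k : ℕ) (hk4 : 4 ≤ k) :
    Submodule.span ℚ (zetaEval '' (oddGenerators k : Set (ℕ × ℕ →₀ ℚ))) ≤ doubleZetaSpace k := by
  have key : ∀ q p : ℕ, 2 ≤ q → 1 ≤ p → q + p = k → doubleZeta q p ∈ doubleZetaSpace k :=
    fun q p hq hp h => Submodule.subset_span ⟨q, p, hq, hp, h, rfl⟩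
  rw [Submodule.span_le]
  rintro _ ⟨x, hx, rfl⟩
  rcases mem_oddGenerators.1 hx with ⟨j, hj, rfl⟩ | ⟨j, hj, rfl⟩ | ⟨j, hj, rfl⟩ <;>
    rw [mem_oddIcc] at hj
  · rw [zetaEval_zetaSymbol]
    exact key _ _ (by omega) (by omega) (by omega)
  · rw [zetaEval_zetaSymbol]
    exact key _ _ (by omega) (by omega) (by omega)
  · rw [map_add, zetaEval_zetaSymbol, zetaEval_zetaSymbol]
    exact add_mem (key _ _ (by omega) (by omega) (by omega))
      (key _ _ (by omega) (by omega) (by omega))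

/-- A `ℚ`-linear functional killing the generators kills all double zeta values. -/
theorem map_doubleZeta_eq_zero {k : ℕ} (hk : Even k) (hk4 : 4 ≤ k) (φ : ℝ →ₗ[ℚ] ℚ)
    (hφ : ∀ x ∈ oddGenerators k, φ (zetaEval x) = 0) {q p : ℕ} (hq : 2 ≤ q) (hp : 1 ≤ p)
    (hqp : q + p = k) : φ (doubleZeta q p) = 0 := by
  obtain ⟨w, rfl⟩ : ∃ w, k = w + 2 := ⟨k - 2, by omega⟩
  have hw : Even w := by simpa [Nat.even_add] using hk
  have hgen1 : ∀ j, Odd j → 3 ≤ j → j ≤ (w + 2 + 2) / 3 → φ (doubleZeta j (w + 2 - j)) = 0 := by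
    intro j hj h3 hle
    have := hφ _ (mem_oddGenerators.2 (Or.inl ⟨j, mem_oddIcc.2 ⟨⟨h3, hle⟩, hj⟩, rfl⟩))
    rwa [zetaEval_zetaSymbol] at this
  have hgen2 : ∀ j, Odd j → j ≤ (w + 2 + 2) / 3 → φ (doubleZeta (w + 2 - j) j) = 0 := by
    intro j hj hle
    have := hφ _ (mem_oddGenerators.2 (Or.inr (Or.inl ⟨j, mem_oddIcc.2 ⟨⟨hj.pos, hle⟩, hj⟩, rfl⟩)))
    rwa [zetaEval_zetaSymbol] at this
  have hgen3 : ∀ j, Odd j → (w + 2 + 5) / 3 ≤ j → j ≤ (w + 2) / 2 →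
      φ (doubleZeta j (w + 2 - j)) + φ (doubleZeta (w + 2 - j) j) = 0 := by
    intro j hj hle hle'
    have := hφ _ (mem_oddGenerators.2 (Or.inr (Or.inr ⟨j, mem_oddIcc.2 ⟨⟨hle, hle'⟩, hj⟩, rfl⟩)))
    rwa [map_add, zetaEval_zetaSymbol, zetaEval_zetaSymbol, map_add] at this
  -- Index 0 would be the divergent `ζ(1, k-1)`; the value 0 is consistent with the shuffle
  -- relations, where its binomial coefficients vanish for `0 < i < w`.
  let g : ℕ → ℚ := fun i => if i = 0 then 0 else φ (doubleZeta (i + 1) (w + 1 - i))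
  let z : ℚ := φ (zetaValue (w + 2))
  have hg : ∀ i, i ≠ 0 → g i = φ (doubleZeta (i + 1) (w + 1 - i)) := fun i hi => if_neg hi
  have hg0 : g 0 = 0 := if_pos rfl
  have hφmul : ∀ (c : ℕ) (x : ℝ), φ ((c : ℝ) * x) = c * φ x := by
    intro c x
    rw [← nsmul_eq_mul, map_nsmul, nsmul_eq_mul]
  have hds : ∀ i ≤ w, g i + g (w - i) + z =
      ∑ a ∈ Finset.range (w + 1), ((a.choose i : ℚ) + a.choose (w - i)) * g a := by
    -- The boundary cases `i = 0` and `i = w` are not products of convergent zeta values; Euler's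
    -- sum formula takes their place.
    have h0 : g w + z =
        ∑ a ∈ Finset.range (w + 1), ((a.choose 0 : ℚ) + a.choose w) * g a := by
      simp only [Nat.choose_zero_right, Nat.cast_one, add_mul, one_mul, Finset.sum_add_distrib]
      have h1 : ∑ a ∈ Finset.range (w + 1), (a.choose w : ℚ) * g a = g w := by
        rw [Finset.sum_range_succ, Finset.sum_eq_zero, Nat.choose_self, Nat.cast_one, one_mul,
          zero_add]
        intro a ha
        simp [Nat.choose_eq_zero_of_lt (Finset.mem_range.1 ha)]
      rw [h1, Finset.sum_range_succ', hg0, add_zero, add_comm]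
      congr 1
      rw [show z = φ (zetaValue (w + 2)) from rfl, ← sum_doubleZeta_eq_zetaValue (by omega), map_sum]
      refine Finset.sum_congr rfl fun a _ => ?_
      rw [hg _ (by omega), Nat.add_sub_add_right]
    intro i hi
    rcases Nat.eq_zero_or_pos i with rfl | hi0
    · rw [hg0, Nat.sub_zero, zero_add, h0]
    rcases hi.eq_or_lt with rfl | hiw
    · rw [Nat.sub_self, hg0, add_zero, h0]
      exact Finset.sum_congr rfl fun a _ => by ring
    have h1 := (zetaValue_mul_eq_stuffle (r := i + 1) (s := w - i + 1) (by omega) (by omega)).symm.trans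
      (zetaValue_mul_eq_shuffle (by omega) (by omega))
    have h2 := congrArg φ h1
    rw [map_add, map_add, map_sum, show i + 1 + (w - i + 1) = w + 2 by omega,
      show i + (w - i) = w by omega] at h2
    rw [hg i hi0.ne', hg (w - i) (by omega), show w + 1 - i = w - i + 1 by omega,
      show w + 1 - (w - i) = i + 1 by omega, h2]
    refine Finset.sum_congr rfl fun a ha => ?_
    have ha' := Finset.mem_range.1 ha
    rw [← Nat.cast_add, hφmul, ← Nat.cast_add]
    rcases Nat.eq_zero_or_pos a with rfl | ha0
    · rw [Nat.choose_eq_zero_of_lt hi0, Nat.choose_eq_zero_of_lt (by omega : 0 < w - i)]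
      simp
    · rw [hg a ha0.ne', show w + 1 - a = w - a + 1 by omega]
  have hodd : z = 0 → ∀ i ≤ w, Odd i → g i + g (w - i) = 0 := by
    intro hz i hi hio
    have hwi : Odd (w - i) := Nat.Even.sub_odd hi hw hio
    have hi0 := hio.pos
    have hwi0 := hwi.pos
    obtain ⟨c, hc⟩ := exists_rat_zetaValue_mul (r := i + 1) (s := w - i + 1) hio.add_one
      hwi.add_one (by omega) (by omega)
    rw [zetaValue_mul_eq_stuffle (by omega) (by omega),
      show i + 1 + (w - i + 1) = w + 2 by omega, ← Rat.smul_def] at hc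
    have h2 := congrArg φ hc
    rw [map_add, map_add, map_smul, show φ (zetaValue (w + 2)) = 0 from hz] at h2
    rw [hg i hi0.ne', hg (w - i) hwi0.ne', show w + 1 - i = w - i + 1 by omega,
      show w + 1 - (w - i) = i + 1 by omega]
    simpa using h2
  have hlow : ∀ i, Even i → 3 * i ≤ w + 1 → g i = 0 := by
    intro i hi h3
    rcases Nat.eq_zero_or_pos i with rfl | hi0
    · exact hg0
    rw [hg i hi0.ne', show w + 1 - i = w + 2 - (i + 1) by omega]
    have : 2 ≤ i := by
      obtain ⟨m, rfl⟩ := hi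
      omega
    exact hgen1 _ hi.add_one (by omega) (by omega)
  have hhigh : ∀ i, Even i → 3 * i ≤ w + 1 → g (w - i) = 0 := by
    intro i hi h3
    rw [hg (w - i) (by omega), show w + 1 - (w - i) = i + 1 by omega,
      show w - i + 1 = w + 2 - (i + 1) by omega]
    exact hgen2 _ hi.add_one (by omega)
  have hev' : ∀ i, 2 * i ≤ w → Even i → g i + g (w - i) = 0 := by
    intro i hi hie
    rcases le_or_gt (3 * i) (w + 1) with h3 | h3
    · rw [hlow i hie h3, hhigh i hie h3, add_zero]
    · rw [hg i (by omega), hg (w - i) (by omega), show w + 1 - (w - i) = i + 1 by omega,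
        show w - i + 1 = w + 2 - (i + 1) by omega, show w + 1 - i = w + 2 - (i + 1) by omega]
      exact hgen3 _ hie.add_one (by omega) (by omega)
  have hev : ∀ i ≤ w, Even i → g i + g (w - i) = 0 := by
    intro i hi hie
    rcases le_total (2 * i) w with h | h
    · exact hev' i h hie
    · have := hev' (w - i) (by omega) ((Nat.even_sub hi).2 (by tauto))
      rwa [show w - (w - i) = i by omega, add_comm] at this
  have h := eq_zero_of_doubleShuffle hw (by omega) hds hodd hev hlow (q - 1) (by omega)
  rw [hg _ (by omega)] at h
  convert h using 3 <;> omega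

theorem span_zetaEval_oddGenerators {k : ℕ} (hk : Even k) (hk4 : 4 ≤ k) :
    Submodule.span ℚ (zetaEval '' (oddGenerators k : Set (ℕ × ℕ →₀ ℚ))) = doubleZetaSpace k := by
  refine le_antisymm (span_zetaEval_oddGenerators_le k hk4) (Submodule.span_le.2 ?_)
  rintro _ ⟨q, p, hq, hp, hqp, rfl⟩
  by_contra hx
  obtain ⟨φ, hne, hle⟩ := Submodule.exists_le_ker_of_notMem hx
  exact hne (map_doubleZeta_eq_zero hk hk4 φ
    (fun x hx => hle (Submodule.subset_span ⟨x, hx, rfl⟩)) hq hp hqp)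

/-! ### Counting generators and middle indices -/

theorem card_filter_odd_range (n : ℕ) : ((Finset.range n).filter Odd).card = n / 2 := by
  induction n with
  | zero => simp
  | succ n ih =>
    rw [Finset.range_add_one, Finset.filter_insert]
    split_ifs with h
    · rw [Finset.card_insert_of_notMem (by simp), ih]
      obtain ⟨m, rfl⟩ := h
      omega
    · rw [ih]
      rw [Nat.not_odd_iff_even] at h
      obtain ⟨m, rfl⟩ := h
      omega

theorem card_filter_odd_Ico {a b : ℕ} (h : a ≤ b) :
    ((Finset.Ico a b).filter Odd).card + a / 2 = b / 2 := by
  rw [← card_filter_odd_range a, ← card_filter_odd_range b,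
    ← Finset.card_union_of_disjoint, ← Finset.filter_union]
  · congr 2
    ext x
    simp only [Finset.mem_union, Finset.mem_Ico, Finset.mem_range]
    omega
  · refine Finset.disjoint_left.2 fun x hx hx' => ?_
    simp only [Finset.mem_filter, Finset.mem_Ico, Finset.mem_range] at hx hx'
    omega

theorem card_oddIcc {a b : ℕ} (h : a ≤ b + 1) : (oddIcc a b).card + a / 2 = (b + 1) / 2 := by
  rw [← card_filter_odd_Ico h]
  rfl

theorem dimM_eq {k : ℕ} (hk : Even k) :
    dimM k = if k % 12 = 2 then k / 12 else k / 12 + 1 := by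
  refine Module.finrank_eq_of_rank_eq ?_
  rw [ModularForm.dimension_level_one k hk]
  simp only [Nat.ModEq, Nat.reduceMod]
  split_ifs with h <;> simp [h]

theorem card_oddMiddle {k : ℕ} (hk : Even k) (hk4 : 4 ≤ k) :
    ((oddMiddle k).card : ℤ) = (dimM k : ℤ) - 1 := by
  obtain ⟨m, rfl⟩ := hk
  rw [dimM_eq ⟨m, rfl⟩]
  rcases le_or_gt ((m + m + 5) / 3) ((m + m) / 2) with h | h
  · have h1 := card_filter_odd_Ico h
    change (oddMiddle (m + m)).card + _ = _ at h1
    -- Both the floors and the dimension formula depend on `k = 2 * m` modulo 12, hence on `m`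
    -- modulo 6.
    obtain ⟨n, r, hr, rfl⟩ : ∃ n r, r < 6 ∧ m = 6 * n + r :=
      ⟨m / 6, m % 6, Nat.mod_lt _ (by norm_num), by omega⟩
    interval_cases r <;> split_ifs <;> omega
  · have h1 : (oddMiddle (m + m)).card = 0 := by
      rw [oddMiddle, Finset.Ico_eq_empty (by omega)]
      rfl
    split_ifs <;> omega

theorem zetaSymbol_apply (q p a b : ℕ) :
    zetaSymbol q p (a, b) = if q = a ∧ p = b then 1 else 0 := by
  simp [zetaSymbol, Finsupp.single_apply, Prod.ext_iff]

theorem zetaSymbol_inj {q p a b : ℕ} (h : zetaSymbol q p = zetaSymbol a b) : q = a ∧ p = b := by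
  have := DFunLike.congr_fun h (a, b)
  by_contra hne
  simp [zetaSymbol_apply, hne] at this

theorem zetaSymbol_add_apply_ne_zero {k i j : ℕ}
    (h : (zetaSymbol j (k - j) + zetaSymbol (k - j) j) (i, k - i) ≠ 0) :
    i = j ∨ (i = k - j ∧ j = k - i) := by
  by_contra hne
  apply h
  rw [Finsupp.add_apply, zetaSymbol_apply, zetaSymbol_apply, if_neg (by omega), if_neg (by omega),
    add_zero]

theorem zetaSymbol_add_apply_self_ne_zero (q p : ℕ) :
    (zetaSymbol q p + zetaSymbol p q) (q, p) ≠ 0 := by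
  rw [Finsupp.add_apply, zetaSymbol_apply, zetaSymbol_apply, if_pos ⟨rfl, rfl⟩]
  split_ifs <;> norm_num

theorem card_oddGenerators {k : ℕ} (hk : Even k) (hk4 : 4 ≤ k) :
    ((oddGenerators k).card : ℤ) = (k : ℤ) / 2 - (dimM k : ℤ) := by
  rw [oddGenerators, Finset.card_union_of_disjoint, Finset.card_union_of_disjoint,
    Finset.card_image_of_injOn, Finset.card_image_of_injOn, Finset.card_image_of_injOn]
  · have h1 : (oddIcc 3 ((k + 2) / 3)).card + 1 = ((k + 2) / 3 + 1) / 2 := card_oddIcc (by omega)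
    have h2 : (oddIcc 1 ((k + 2) / 3)).card + 0 = ((k + 2) / 3 + 1) / 2 := card_oddIcc (by omega)
    have h3 := card_oddIcc (a := (k + 5) / 3) (b := k / 2)
    rw [dimM_eq hk]
    obtain ⟨m, rfl⟩ := hk
    have h4 := h3 (by omega)
    obtain ⟨n, r, hr, rfl⟩ : ∃ n r, r < 6 ∧ m = 6 * n + r :=
      ⟨m / 6, m % 6, Nat.mod_lt _ (by norm_num), by omega⟩
    interval_cases r <;> split_ifs <;> omega
  · intro i hi j hj h
    rw [Finset.mem_coe, mem_oddIcc] at hi hj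
    -- The coefficient at `(i, k - i)` determines `j` up to `j ↦ k - j`; the bound `k / 2` selects
    -- one of the two.
    have h1 : (zetaSymbol j (k - j) + zetaSymbol (k - j) j) (i, k - i) ≠ 0 := by
      rw [← show _ = zetaSymbol j (k - j) + zetaSymbol (k - j) j from h]
      exact zetaSymbol_add_apply_self_ne_zero _ _
    rcases zetaSymbol_add_apply_ne_zero h1 with h2 | h2 <;> omega
  · intro i _ j _ h
    exact (zetaSymbol_inj h).2
  · intro i _ j _ h
    exact (zetaSymbol_inj h).1
  · refine Finset.disjoint_left.2 fun x hx hx' => ?_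
    simp only [Finset.mem_image, mem_oddIcc] at hx hx'
    obtain ⟨i, hi, rfl⟩ := hx
    obtain ⟨j, hj, h⟩ := hx'
    have := zetaSymbol_inj h
    omega
  · refine Finset.disjoint_left.2 fun x hx hx' => ?_
    simp only [Finset.mem_union, Finset.mem_image, mem_oddIcc] at hx hx'
    obtain ⟨j, hj, rfl⟩ := hx'
    have h1 := zetaSymbol_add_apply_self_ne_zero j (k - j)
    rcases hx with ⟨i, hi, h⟩ | ⟨i, hi, h⟩ <;> rw [← h, zetaSymbol_apply] at h1 <;>
    · apply h1
      rw [if_neg]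
      omega

/-! ### Relations with prescribed asymmetry -/

/-- Elements of the span of the generators are symmetric at the middle indices and are determined
by their odd entries. -/
theorem span_oddGenerators_spec {k : ℕ} (hk : Even k) (hk4 : 4 ≤ k) {γ : ℕ × ℕ →₀ ℚ}
    (hγ : γ ∈ Submodule.span ℚ (oddGenerators k : Set (ℕ × ℕ →₀ ℚ))) :
    (∀ j ∈ oddMiddle k, γ (j, k - j) = γ (k - j, j)) ∧
      zetaEval γ = ∑ j ∈ oddIcc 3 (k - 1), (γ (j, k - j) : ℝ) * doubleZeta j (k - j) := by
  have hsym : ∀ i ∈ oddIcc 3 (k - 1), zetaEval (zetaSymbol i (k - i)) =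
      ∑ j ∈ oddIcc 3 (k - 1), (zetaSymbol i (k - i) (j, k - j) : ℝ) * doubleZeta j (k - j) := by
    intro i hi
    rw [Finset.sum_eq_single i]
    · simp [zetaSymbol_apply]
    · intro j _ hj
      simp [zetaSymbol_apply, hj.symm]
    · exact fun h => absurd hi h
  have hadd : ∀ x y : ℕ × ℕ →₀ ℚ,
      ∑ j ∈ oddIcc 3 (k - 1), (((x + y) (j, k - j) : ℚ) : ℝ) * doubleZeta j (k - j) =
      ∑ j ∈ oddIcc 3 (k - 1), (x (j, k - j) : ℝ) * doubleZeta j (k - j) +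
      ∑ j ∈ oddIcc 3 (k - 1), (y (j, k - j) : ℝ) * doubleZeta j (k - j) := by
    intro x y
    rw [← Finset.sum_add_distrib]
    refine Finset.sum_congr rfl fun j _ => ?_
    rw [Finsupp.add_apply]
    push_cast
    ring
  induction hγ using Submodule.span_induction with
  | zero => simp
  | add x y _ _ hx hy =>
    refine ⟨fun j hj => ?_, ?_⟩
    · rw [Finsupp.add_apply, Finsupp.add_apply, hx.1 j hj, hy.1 j hj]
    · rw [map_add, hx.2, hy.2, hadd]
  | smul a x _ hx =>
    refine ⟨fun j hj => ?_, ?_⟩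
    · rw [Finsupp.smul_apply, Finsupp.smul_apply, hx.1 j hj]
    · rw [map_smul, hx.2, Rat.smul_def, Finset.mul_sum]
      refine Finset.sum_congr rfl fun j _ => ?_
      rw [Finsupp.smul_apply, smul_eq_mul]
      push_cast
      ring
  | mem x hx =>
    obtain ⟨m, hm⟩ := hk
    have hodd : ∀ j, Odd j → j ≤ k → Odd (k - j) := fun j hj hjk =>
      Nat.Even.sub_odd hjk ⟨m, hm⟩ hj
    rcases mem_oddGenerators.1 hx with ⟨i, hi, rfl⟩ | ⟨i, hi, rfl⟩ | ⟨i, hi, rfl⟩ <;>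
      rw [mem_oddIcc] at hi
    · refine ⟨fun j hj => ?_, hsym i (mem_oddIcc.2 ⟨by omega, hi.2⟩)⟩
      rw [mem_oddMiddle] at hj
      rw [zetaSymbol_apply, zetaSymbol_apply, if_neg (by omega), if_neg (by omega)]
    · refine ⟨fun j hj => ?_, ?_⟩
      · rw [mem_oddMiddle] at hj
        rw [zetaSymbol_apply, zetaSymbol_apply, if_neg (by omega), if_neg (by omega)]
      · have hki : 3 ≤ k - i := by
          obtain ⟨t, ht⟩ := hodd i hi.2 (by omega)
          omega
        have := hsym (k - i) (mem_oddIcc.2 ⟨by omega, hodd i hi.2 (by omega)⟩)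
        rwa [show k - (k - i) = i by omega] at this
    · refine ⟨fun j hj => ?_, ?_⟩
      · simp only [Finsupp.add_apply, zetaSymbol_apply]
        rw [add_comm]
        congr 2 <;> exact propext and_comm
      · rw [hadd, map_add, ← hsym i (mem_oddIcc.2 ⟨by omega, hi.2⟩)]
        have := hsym (k - i) (mem_oddIcc.2 ⟨by omega, hodd i hi.2 (by omega)⟩)
        rw [show k - (k - i) = i by omega] at this
        rw [← this]

/-- For a middle index `i` there is a relation among the `ζ(j, k - j)` with `j` odd whose
antisymmetric part at the middle indices is concentrated at `i`. -/
theorem exists_relation {k : ℕ} (hk : Even k) (hk4 : 4 ≤ k) {i : ℕ} (hi : i ∈ oddMiddle k) :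
    ∃ c : ℕ →₀ ℚ, c.support ⊆ oddIcc 3 (k - 1) ∧
      ∑ j ∈ oddIcc 3 (k - 1), (c j : ℝ) * doubleZeta j (k - j) = 0 ∧
      c i - c (k - i) = 1 ∧ ∀ j ∈ oddMiddle k, j ≠ i → c j = c (k - j) := by
  have hi' := mem_oddMiddle.1 hi
  have hmem : doubleZeta i (k - i) ∈
      Submodule.span ℚ (zetaEval '' (oddGenerators k : Set (ℕ × ℕ →₀ ℚ))) := by
    rw [span_zetaEval_oddGenerators hk hk4]
    exact Submodule.subset_span ⟨i, k - i, by omega, by omega, by omega, rfl⟩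
  rw [Submodule.span_image] at hmem
  obtain ⟨γ, hγ, hγi⟩ := hmem
  obtain ⟨hsymm, heval⟩ := span_oddGenerators_spec hk hk4 hγ
  have hmemIcc : ∀ j ∈ oddMiddle k, j ∈ oddIcc 3 (k - 1) ∧ k - j ∈ oddIcc 3 (k - 1) := by
    intro j hj
    rw [mem_oddMiddle] at hj
    exact ⟨mem_oddIcc.2 ⟨by omega, hj.2⟩,
      mem_oddIcc.2 ⟨by omega, Nat.Even.sub_odd (by omega) hk hj.2⟩⟩
  -- The formal difference of `ζ(i,k-i)` and its expression `γ` by generators, read on first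
  -- arguments. As `γ` is symmetric at `i`, the delta term alone makes `c i - c (k - i) = 1`.
  let c : ℕ →₀ ℚ := ∑ j ∈ oddIcc 3 (k - 1),
    Finsupp.single j ((if j = i then 1 else 0) - γ (j, k - j))
  have hc : ∀ j, c j =
      if j ∈ oddIcc 3 (k - 1) then (if j = i then 1 else 0) - γ (j, k - j) else 0 := by
    intro j
    simp only [c, Finsupp.finsetSum_apply, Finsupp.single_apply]
    exact Finset.sum_ite_eq' _ j _
  refine ⟨c, ?_, ?_, ?_, ?_⟩
  · intro j hj
    by_contra h
    rw [Finsupp.mem_support_iff, hc, if_neg h] at hj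
    exact hj rfl
  · have h1 : ∀ j ∈ oddIcc 3 (k - 1), (c j : ℝ) * doubleZeta j (k - j) =
        (if j = i then doubleZeta j (k - j) else 0) - (γ (j, k - j) : ℝ) * doubleZeta j (k - j) := by
      intro j hj
      rw [hc, if_pos hj]
      split_ifs <;> push_cast <;> ring
    rw [Finset.sum_congr rfl h1, Finset.sum_sub_distrib, ← heval, hγi,
      Finset.sum_ite_eq' _ i, if_pos (hmemIcc i hi).1, sub_self]
  · rw [hc, hc, if_pos (hmemIcc i hi).1, if_pos (hmemIcc i hi).2, if_pos rfl,
      if_neg (by omega : k - i ≠ i), show k - (k - i) = i by omega, hsymm i hi]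
    ring
  · intro j hj hji
    have hj' := mem_oddMiddle.1 hj
    rw [hc, hc, if_pos (hmemIcc j hj).1, if_pos (hmemIcc j hj).2, if_neg hji,
      if_neg (by omega : k - j ≠ i), show k - (k - j) = j by omega, hsymm j hj]

theorem theorem2 (k : ℕ) (hk : Even k) (hk4 : 4 ≤ k) :
    (Submodule.span ℚ (zetaEval '' (oddGenerators k : Set (ℕ × ℕ →₀ ℚ))) = doubleZetaSpace k ∧
      ((oddGenerators k).card : ℤ) = (k : ℤ) / 2 - (dimM k : ℤ)) ∧
    (∃ c : {i // i ∈ oddMiddle k} → (ℕ →₀ ℚ),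
      (∀ i : {i // i ∈ oddMiddle k},
        (c i).support ⊆ oddIcc 3 (k - 1) ∧
        c i ≠ 0 ∧
        ∑ j ∈ oddIcc 3 (k - 1), (c i j : ℝ) * doubleZeta j (k - j) = 0 ∧
        c i (i : ℕ) ≠ c i (k - (i : ℕ)) ∧
        ∀ j ∈ oddMiddle k, j ≠ (i : ℕ) → c i j = c i (k - j)) ∧
      LinearIndependent ℚ c ∧
      ((oddMiddle k).card : ℤ) = (dimM k : ℤ) - 1) := by
  refine ⟨⟨span_zetaEval_oddGenerators hk hk4, card_oddGenerators hk hk4⟩, ?_⟩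
  choose c hsupp hrel hdiff hsymm using
    fun i : {i // i ∈ oddMiddle k} => exists_relation hk hk4 i.2
  refine ⟨c, fun i => ⟨hsupp i, ?_, hrel i, ?_, hsymm i⟩, ?_, card_oddMiddle hk hk4⟩
  · intro h
    have := hdiff i
    simp [h] at this
  · intro h
    have := hdiff i
    simp [h] at this
  · rw [Fintype.linearIndependent_iff]
    intro a ha i
    have h1 := DFunLike.congr_fun ha (i : ℕ)
    have h2 := DFunLike.congr_fun ha (k - (i : ℕ))
    simp only [Finsupp.finsetSum_apply, Finsupp.smul_apply, smul_eq_mul, Finsupp.zero_apply] at h1 h2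
    -- The functionals `c ↦ c i - c (k - i)` are dual to the family of relations, so each one
    -- isolates a coefficient.
    have h3 : ∑ j, a j * (c j i - c j (k - i)) = 0 := by
      simp only [mul_sub, Finset.sum_sub_distrib, h1, h2, sub_self]
    rw [Finset.sum_eq_single i] at h3
    · rwa [hdiff i, mul_one] at h3
    · intro j _ hji
      rw [hsymm j i i.2 (fun h => hji (Subtype.ext h.symm)), sub_self, mul_zero]
    · exact fun h => absurd (Finset.mem_univ i) h
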